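/- Let $\kappa$ be an infinite regular cardinal. An \emph{ideal} on a set $X$ is a family of subsets of $X$ that contains $\emptyset$ and is closed under subsets and finite unions; it is \emph{$\delta$-complete} if it is closed under unions of fewer than $\delta$ of its members. A \emph{normal ideal} on $\kappa^+$ is a proper $\kappa^+$-complete ideal that contains all singletons and is closed under diagonal unions $\{\beta<\kappa^+ : \exists \alpha<\beta\ (\beta\in A_\alpha)\}$. Let $\mathrm{Col}(\kappa,\kappa^+)$ be the set of partial functions from $\kappa$ to $\kappa^+$ defined at fewer than $\kappa$ many points, ordered by reverse inclusion, and let $\mathcal B(\mathrm{Col}(\kappa,\kappa^+))$ be its Boolean completion (the algebra of its regular open subsets). Let $\mathrm{bd}$ be the ideal of bounded subsets of $\kappa$. Suppose that $J$ is a normal ideal on $\kappa^+$ with $\mathcal P(\kappa^+)/J\cong\mathcal B(\mathrm{Col}(\kappa,\kappa^+))$, and that $\diamondsuit_{\kappa^+}(\mathrm{cof}(\kappa))$ holds: there are sets $d_\alpha$, for $\alpha\in S=\{\alpha<\kappa^+:\mathrm{cf}(\alpha)=\kappa\}$, such that for every $Y\subseteq\kappa^+$ the set $\{\alpha\in S: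 Y\cap\alpha=d_\alpha\}$ is stationary in $\kappa^+$. Then there are a proper $\kappa$-complete ideal $K\supseteq J$ on $\kappa^+$ and a function $\pi:\kappa^+\to\kappa$ such that: 1. for all $A\subseteq\kappa$, $|A|<\kappa$ if and only if $\pi^{-1}[A]\in K$; 2. $[A]_{\mathrm{bd}}\mapsto[\pi^{-1}[A]]_K$ is a well-defined isomorphism of Boolean algebras from $\mathcal P(\kappa)/\mathrm{bd}$ onto $\mathcal P(\kappa^+)/K$; 3. for every ordinal $\mu\le\kappa$ (in particular, for every cardinal $\mu\le\kappa$), $[f]_{\mathrm{bd}}\mapsto[f\circ\pi]_K$ is a well-defined bijection from the reduced power $\mu^\kappa/\mathrm{bd}$ onto the reduced power $\mu^{\kappa^+}/K$. -/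

import Mathlib

open Cardinal Ordinal Order Set

universe u

namespace BooleanTransfer

/-! ### Ideals on a set and their quotients

An ideal on a set `X` is an order ideal of `Set X`. -/

section Quotients

variable {X : Type u}

/-- `I` is closed under unions of fewer than `c` of its members. -/
def IsCompleteIdeal (c : Cardinal.{u}) (I : Order.Ideal (Set X)) : Prop :=
  ∀ S : Set (Set X), #S < c → (∀ A ∈ S, A ∈ I) → ⋃₀ S ∈ I

theorem union_mem {I : Order.Ideal (Set X)} {A B : Set X} (hA : A ∈ I) (hB : B ∈ I) :
    A ∪ B ∈ I :=
  Order.Ideal.sup_mem hA hB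

theorem mem_of_subset {I : Order.Ideal (Set X)} {A B : Set X} (h : A ⊆ B) (hB : B ∈ I) :
    A ∈ I :=
  I.lower h hB

theorem empty_mem (I : Order.Ideal (Set X)) : (∅ : Set X) ∈ I :=
  Order.Ideal.bot_mem I

/-- Equality modulo `I`: the symmetric difference of the two sets is in `I`. -/
def modSetoid (I : Order.Ideal (Set X)) : Setoid (Set X) where
  r A B := (A \ B) ∪ (B \ A) ∈ I
  iseqv :=
    { refl := fun A => by simpa using empty_mem I
      symm := fun {A B} h => by rwa [union_comm]
      trans := fun {A B C} h₁ h₂ => by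
        refine mem_of_subset (fun x hx => ?_) (union_mem h₁ h₂)
        simp only [mem_union, mem_sdiff] at hx ⊢
        tauto }

/-- The quotient `𝒫(X)/I`. -/
def PowerMod (I : Order.Ideal (Set X)) : Type u :=
  Quotient (modSetoid I)

/-- The class `[A]_I`. -/
def PowerMod.mk (I : Order.Ideal (Set X)) (A : Set X) : PowerMod I :=
  Quotient.mk (modSetoid I) A

/-- The quotient `𝒫(X)/I` as a Boolean algebra: `[A] ≤ [B]` iff `A \ B ∈ I`, and the
operations are induced by union, intersection and complement. -/
instance (I : Order.Ideal (Set X)) : BooleanAlgebra (PowerMod I) where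
  le := Quotient.lift₂ (fun A B => A \ B ∈ I) (by
    intro A B A' B' hA hB
    refine propext ⟨fun h => ?_, fun h => ?_⟩ <;>
    · refine mem_of_subset (fun x hx => ?_) (union_mem h (union_mem hA hB))
      simp only [mem_union, mem_sdiff] at hx ⊢
      tauto)
  le_refl := by
    rintro ⟨A⟩
    change A \ A ∈ I
    simpa using empty_mem I
  le_trans := by
    rintro ⟨A⟩ ⟨B⟩ ⟨C⟩ (h₁ : A \ B ∈ I) (h₂ : B \ C ∈ I)
    change A \ C ∈ I
    refine mem_of_subset (fun x hx => ?_) (union_mem h₁ h₂)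
    simp only [mem_union, mem_sdiff] at hx ⊢
    tauto
  le_antisymm := by
    rintro ⟨A⟩ ⟨B⟩ (h₁ : A \ B ∈ I) (h₂ : B \ A ∈ I)
    exact Quotient.sound (union_mem h₁ h₂)
  sup := Quotient.map₂ (· ∪ ·) (by
    intro A A' hA B B' hB
    refine mem_of_subset (fun x hx => ?_) (union_mem hA hB)
    simp only [mem_union, mem_sdiff] at hx ⊢
    tauto)
  le_sup_left := by
    rintro ⟨A⟩ ⟨B⟩
    change A \ (A ∪ B) ∈ I
    refine mem_of_subset (fun x hx => ?_) (empty_mem I)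
    simp only [mem_union, mem_sdiff] at hx
    tauto
  le_sup_right := by
    rintro ⟨A⟩ ⟨B⟩
    change B \ (A ∪ B) ∈ I
    refine mem_of_subset (fun x hx => ?_) (empty_mem I)
    simp only [mem_union, mem_sdiff] at hx
    tauto
  sup_le := by
    rintro ⟨A⟩ ⟨B⟩ ⟨C⟩ (h₁ : A \ C ∈ I) (h₂ : B \ C ∈ I)
    change (A ∪ B) \ C ∈ I
    refine mem_of_subset (fun x hx => ?_) (union_mem h₁ h₂)
    simp only [mem_union, mem_sdiff] at hx ⊢
    tauto
  inf := Quotient.map₂ (· ∩ ·) (by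
    intro A A' hA B B' hB
    refine mem_of_subset (fun x hx => ?_) (union_mem hA hB)
    simp only [mem_union, mem_inter_iff, mem_sdiff] at hx ⊢
    tauto)
  inf_le_left := by
    rintro ⟨A⟩ ⟨B⟩
    change (A ∩ B) \ A ∈ I
    refine mem_of_subset (fun x hx => ?_) (empty_mem I)
    simp only [mem_inter_iff, mem_sdiff] at hx
    tauto
  inf_le_right := by
    rintro ⟨A⟩ ⟨B⟩
    change (A ∩ B) \ B ∈ I
    refine mem_of_subset (fun x hx => ?_) (empty_mem I)
    simp only [mem_inter_iff, mem_sdiff] at hx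
    tauto
  le_inf := by
    rintro ⟨A⟩ ⟨B⟩ ⟨C⟩ (h₁ : A \ B ∈ I) (h₂ : A \ C ∈ I)
    change A \ (B ∩ C) ∈ I
    refine mem_of_subset (fun x hx => ?_) (union_mem h₁ h₂)
    simp only [mem_union, mem_inter_iff, mem_sdiff] at hx ⊢
    tauto
  le_sup_inf := by
    rintro ⟨A⟩ ⟨B⟩ ⟨C⟩
    change ((A ∪ B) ∩ (A ∪ C)) \ (A ∪ (B ∩ C)) ∈ I
    refine mem_of_subset (fun x hx => ?_) (empty_mem I)
    simp only [mem_union, mem_inter_iff, mem_sdiff] at hx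
    tauto
  top := PowerMod.mk I Set.univ
  bot := PowerMod.mk I ∅
  le_top := by
    rintro ⟨A⟩
    change A \ Set.univ ∈ I
    simpa using empty_mem I
  bot_le := by
    rintro ⟨A⟩
    change ∅ \ A ∈ I
    simpa using empty_mem I
  compl := Quotient.map (·ᶜ) (by
    intro A A' hA
    refine mem_of_subset (fun x hx => ?_) hA
    simp only [mem_union, mem_compl_iff, mem_sdiff] at hx ⊢
    tauto)
  inf_compl_le_bot := by
    rintro ⟨A⟩
    change (A ∩ Aᶜ) \ ∅ ∈ I
    simpa using empty_mem I
  top_le_sup_compl := by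
    rintro ⟨A⟩
    change Set.univ \ (A ∪ Aᶜ) ∈ I
    simpa using empty_mem I

/-- Equality modulo `I` of functions on `X`. -/
def funSetoid (I : Order.Ideal (Set X)) (M : Type u) : Setoid (X → M) where
  r f g := {x | f x ≠ g x} ∈ I
  iseqv :=
    { refl := fun f => by simpa using empty_mem I
      symm := fun {f g} h => by simpa only [ne_comm] using h
      trans := fun {f g h} h₁ h₂ => by
        refine mem_of_subset (fun x hx => ?_) (union_mem h₁ h₂)
        by_contra hc
        simp only [mem_union, mem_ofPred_eq, not_or, not_not] at hc
        exact hx (hc.1.trans hc.2) }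

/-- The reduced power `M^X/I`. -/
def ReducedPower (I : Order.Ideal (Set X)) (M : Type u) : Type u :=
  Quotient (funSetoid I M)

/-- The class `[f]_I`. -/
def ReducedPower.mk (I : Order.Ideal (Set X)) {M : Type u} (f : X → M) : ReducedPower I M :=
  Quotient.mk (funSetoid I M) f

end Quotients

/-! ### Ideals on cardinals -/

/-- A cardinal `c` regarded as a well-ordered set: the set of ordinals below the initial
ordinal of `c`. -/
abbrev Below (c : Cardinal.{u}) : Type u :=
  c.ord.ToType

/-- Normal ideals on a cardinal `c`: proper `c`-complete ideals that contain all singletons and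
are closed under diagonal unions. -/
structure IsNormalIdeal {c : Cardinal.{u}} (J : Order.Ideal (Set (Below c))) : Prop where
  proper : J.IsProper
  complete : IsCompleteIdeal c J
  singleton_mem : ∀ a : Below c, {a} ∈ J
  diagonal_mem : ∀ A : Below c → Set (Below c), (∀ a, A a ∈ J) → {b | ∃ a < b, b ∈ A a} ∈ J

theorem nonempty_below {κ : Cardinal.{u}} (hκ : κ.IsRegular) : Nonempty (Below κ) :=
  Ordinal.nonempty_toType_iff.2 hκ.ord_pos.ne'

/-- The ideal `bd` of bounded subsets of `κ`. -/
def bd {κ : Cardinal.{u}} (hκ : κ.IsRegular) : Order.Ideal (Set (Below κ)) where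
  carrier := {A | BddAbove A}
  lower' := fun _ _ h hA => BddAbove.mono h hA
  nonempty' := ⟨∅, haveI := nonempty_below hκ; bddAbove_empty⟩
  directed' := fun A hA B hB =>
    ⟨A ∪ B, haveI := nonempty_below hκ; BddAbove.union hA hB, subset_union_left,
      subset_union_right⟩

/-- The set of points of `c` of cofinality `κ`, where a point `a` is identified with its set of
predecessors. -/
def cofPoints (c κ : Cardinal.{u}) : Set (Below c) :=
  {a | Order.cof (Iio a) = κ}

/-- The diamond principle for a set `S` of points of `c`. -/
def Diamond (c : Cardinal.{u}) (S : Set (Below c)) : Prop :=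
  ∃ d : Below c → Set (Below c),
    ∀ Y : Set (Below c), IsStationary {a | a ∈ S ∧ Y ∩ Iio a = d a}

/-! ### The collapse and the Boolean completion -/

/-- `Col(κ, lam)`: partial functions from `κ` to `lam` defined at fewer than `κ` many points. -/
@[ext]
structure Col (κ lam : Cardinal.{u}) : Type u where
  toPFun : Below κ →. Below lam
  card_dom_lt : #toPFun.Dom < κ

/-- The order of `Col(κ, lam)` is reverse inclusion (of graphs). -/
instance (κ lam : Cardinal.{u}) : PartialOrder (Col κ lam) where
  le p q := ∀ a b, b ∈ q.toPFun a → b ∈ p.toPFun a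
  le_refl _ _ _ h := h
  le_trans _ _ _ h₁ h₂ a b h := h₁ a b (h₂ a b h)
  le_antisymm _ _ h₁ h₂ := Col.ext (PFun.ext fun a b => ⟨h₂ a b, h₁ a b⟩)

/-- The Boolean completion `𝓑(P)`: the regular open subsets of `P`, where the open sets are the
downward closed sets. The pseudocomplement of an open set `U` is the set of conditions with no
extension in `U`, and `U` is regular iff it equals its double pseudocomplement. -/
abbrev BooleanCompletion (P : Type u) [PartialOrder P] : Type u :=
  Heyting.Regular (LowerSet P)

end BooleanTransfer

open BooleanTransfer

/-!
Write `p ⊩ A` when the condition `p ∈ Col(κ, κ⁺)` lies below the element of the Boolean completion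
that corresponds to `[A]_J`. The ideal `K` is defined from a *tower*: a sequence of length `κ⁺` of
`κ`-sequences `s γ : κ → Col(κ, κ⁺)`, descending modulo bounded subsets of `κ`. A set belongs to
`K` iff its complement is forced by almost all terms of some `s γ`.

The tower lies below an antichain `p₀ : κ → Col(κ, κ⁺)`. Completeness of `J` realizes the antichain
by a partition of `κ⁺`, that is, by a function `π : κ⁺ → κ` such that `p₀ α ⊩ π⁻¹{α}`
(`exists_projection`). So almost all terms `s γ α` force the generic point to project to `α`, and
`π⁻¹[A] ∈ K` iff `A` is bounded (`preimage_mem_towerIdeal_iff`). The tower also meets every dense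
set `D`: some `s γ` has all its terms in `D`. Given `h : κ⁺ → M` with `|M| ≤ κ`, the conditions
that decide the value of `h` are dense, since `J` is `κ⁺`-complete; if `f α` is the value decided by
`s γ α`, then `h` and `f ∘ π` agree modulo `K` (`exists_comp_eq_mod_towerIdeal`). This gives the
surjectivity in both isomorphisms; `𝒫(κ)/bd` is the case of characteristic functions.

The tower is built in `κ⁺` steps (`exists_isTower`). Lower bounds at limits exist because
`κ`-sequences of conditions modulo bounded sets are closed under descending sequences of length less
than `κ⁺` (`Col.exists_eventually_le`); the lower bounds are coordinatewise unions of fewer than `κ`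
conditions, so `s γ` can be kept within the conditions with values below `γ`. There are up to `2^(κ⁺)`
dense sets but only `κ⁺` steps, so the dense sets are not enumerated but guessed by the diamond
sequence. At a point `γ` of cofinality `κ` the conditions with values below `γ` are the union of
those with values below some `δ < γ`, so that a closure argument makes a dense set dense among
them. This needs that at most `κ` many conditions have values below a given `δ < κ⁺`, which amounts
to `κ^{<κ} = κ`. That equation follows from the existence of the isomorphism (`mk_fun_le`).
-/

namespace BooleanTransfer

/-! ### Bounds and recursion on regular cardinals -/

theorem exists_forall_lt {c : Cardinal.{u}} (hc : c.IsRegular) {ι : Type u} (hι : #ι < c)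
    (f : ι → Below c) : ∃ b, ∀ i, f i < b := by
  have h : ¬ IsCofinal (range f) := fun h => by
    have h₁ : c ≤ #(range f) := by
      have := Order.cof_le h
      rwa [Ordinal.cof_toType, hc.cof_ord] at this
    exact (h₁.trans mk_range_le).not_gt hι
  rw [IsCofinal] at h
  push Not at h
  obtain ⟨b, hb⟩ := h
  exact ⟨b, fun i => hb _ (mem_range_self i)⟩

theorem eventually_forall {κ : Cardinal.{u}} (hκ : κ.IsRegular) {ι : Type u} (hι : #ι < κ)
    {P : ι → Below κ → Prop} (h : ∀ i, ∀ᶠ α in Filter.atTop, P i α) :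
    ∀ᶠ α in Filter.atTop, ∀ i, P i α := by
  have := nonempty_below hκ
  simp only [Filter.eventually_atTop] at h ⊢
  choose f hf using h
  obtain ⟨b, hb⟩ := exists_forall_lt hκ hι f
  exact ⟨b, fun α hα i => hf i α ((hb i).le.trans hα)⟩

theorem mk_Iic_below_lt {κ : Cardinal.{u}} (hκ : κ.IsRegular) (b : Below κ) : #(Iic b) < κ := by
  have h : #(Iio b) < κ := by simpa using mk_Iio_lt b
  obtain ⟨b', hb'⟩ := exists_forall_lt hκ (ι := PUnit) (by simpa using hκ.nat_lt 1) fun _ => b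
  have h' : #(Iio b') < κ := by simpa using mk_Iio_lt b'
  exact (mk_le_mk_of_subset fun x hx => lt_of_le_of_lt hx (hb' ⟨⟩)).trans_lt h'

theorem bddAbove_iff_mk_lt {κ : Cardinal.{u}} (hκ : κ.IsRegular) {A : Set (Below κ)} :
    BddAbove A ↔ #A < κ := by
  constructor
  · rintro ⟨b, hb⟩
    exact (mk_le_mk_of_subset (t := Iic b) fun x hx => hb hx).trans_lt (mk_Iic_below_lt hκ b)
  · intro h
    obtain ⟨b, hb⟩ := exists_forall_lt hκ h fun x => (x : Below κ)
    exact ⟨b, fun x hx => (hb ⟨x, hx⟩).le⟩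

/-- Dependent choice along a well-order: if the requirement `G w s q` on the `w`-th term `q`
depends only on the restriction of `s` to the predecessors of `w`, and can be met whenever the
earlier terms meet theirs, then some sequence meets all requirements. -/
theorem exists_seq_of_forall_exists {W Q : Type*} [LinearOrder W] [WellFoundedLT W] [Nonempty Q]
    (G : W → (W → Q) → Q → Prop)
    (hG : ∀ w s s' q, (∀ v < w, s v = s' v) → G w s q → G w s' q)
    (hex : ∀ w s, (∀ v < w, G v s (s v)) → ∃ q, G w s q) :
    ∃ s, ∀ w, G w s (s w) := by
  classical
  let t : (w : W) → ((v : W) → v < w → Q) → W → Q := fun w ih v =>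
    if h : v < w then ih v h else Classical.arbitrary Q
  let s : W → Q := (wellFounded_lt (α := W)).fix fun w ih => Classical.epsilon (G w (t w ih))
  have hs : ∀ w, s w = Classical.epsilon (G w (t w fun v _ => s v)) := fun w =>
    WellFounded.fix_eq _ _ _
  have ht : ∀ w, ∀ v < w, t w (fun v _ => s v) v = s v := fun w v h => by simp [t, h]
  refine ⟨s, fun w => ?_⟩
  induction w using WellFoundedLT.induction with
  | ind w ih =>
    obtain ⟨q, hq⟩ := hex w s ih
    refine hG w _ s _ (ht w) ?_
    rw [hs w]
    exact Classical.epsilon_spec (p := G w (t w fun v _ => s v))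
      ⟨q, hG w s _ q (fun v h => (ht w v h).symm) hq⟩

/-- The closure points of a function on an uncountable regular cardinal form a club. -/
theorem isClub_closurePoints {c : Cardinal.{u}} (hc : c.IsRegular) (hc' : ℵ₀ < c)
    (f : Below c → Below c) : IsClub {γ | ∀ δ < γ, f δ ≤ γ} := by
  refine ⟨fun d hd _ _ a ha δ hδ => ?_, fun γ₀ => ?_⟩
  · obtain ⟨x, hx, hδx⟩ := (lt_isLUB_iff ha).1 hδ
    exact (hd hx δ hδx).trans (ha.1 hx)
  · have h : ∀ γ, ∃ γ', ∀ δ ≤ γ, f δ ≤ γ' := fun γ => by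
      obtain ⟨b, hb⟩ := exists_forall_lt hc (mk_Iic_below_lt hc γ) fun δ => f δ
      exact ⟨b, fun δ hδ => (hb ⟨δ, hδ⟩).le⟩
    choose g hg using h
    let x : ℕ → Below c := fun n => g^[n] γ₀
    have hne : {b | ∀ n, x n ≤ b}.Nonempty := by
      obtain ⟨b, hb⟩ := exists_forall_lt hc (ι := ULift ℕ) (by simpa using hc') fun n => x n.down
      exact ⟨b, fun n => (hb ⟨n⟩).le⟩
    let b := (wellFounded_lt (α := Below c)).min _ hne
    have hb : ∀ n, x n ≤ b := (wellFounded_lt (α := Below c)).min_mem _ hne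
    refine ⟨b, fun δ hδ => ?_, hb 0⟩
    have : ∃ n, δ < x n := by
      by_contra! hn
      exact (wellFounded_lt (α := Below c)).not_lt_min {b | ∀ n, x n ≤ b} hn hδ
    obtain ⟨n, hn⟩ := this
    refine (hg (x n) δ hn.le).trans ?_
    have : g (x n) = x (n + 1) := (Function.iterate_succ_apply' g n γ₀).symm
    exact this ▸ hb (n + 1)

/-! ### The forcing relation of an isomorphism onto a Boolean completion -/

section Forcing

theorem mem_lowerSet_compl_iff {P : Type u} [PartialOrder P] {U : LowerSet P} {p : P} :
    p ∈ Uᶜ ↔ ∀ q ≤ p, q ∉ U := by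
  constructor
  · intro h q hq hqU
    have : q ∈ U ⊓ Uᶜ := ⟨hqU, Uᶜ.lower hq h⟩
    rw [inf_compl_self] at this
    exact this
  · intro h
    have : LowerSet.Iic p ≤ Uᶜ := by
      rw [le_compl_iff_disjoint_right, disjoint_iff_inf_le]
      exact fun q hq => h q hq.1 hq.2
    exact this (LowerSet.mem_Iic_iff.2 le_rfl)

variable {X P : Type u} [PartialOrder P] {J : Order.Ideal (Set X)}

/-- The condition `p` forces that `A` belongs to the generic ultrafilter on `𝒫(X)/J`, where the
forcing `P` is identified with `𝒫(X)/J` by `e`: the condition `p` belongs to the regular open set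
`e [A]`. -/
def Forces (e : PowerMod J ≃o BooleanCompletion P) (p : P) (A : Set X) : Prop :=
  p ∈ (e (PowerMod.mk J A)).val

variable {e : PowerMod J ≃o BooleanCompletion P} {p q : P} {A B : Set X}

theorem mk_le_mk : PowerMod.mk J A ≤ PowerMod.mk J B ↔ A \ B ∈ J :=
  Iff.rfl

theorem mk_eq_mk : PowerMod.mk J A = PowerMod.mk J B ↔ (A \ B) ∪ (B \ A) ∈ J :=
  Quotient.eq (r := modSetoid J)

theorem Forces.of_le (h : Forces e p A) (hq : q ≤ p) : Forces e q A :=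
  (e (PowerMod.mk J A)).val.lower hq h

theorem Forces.of_diff_mem (h : Forces e p A) (hAB : A \ B ∈ J) : Forces e p B := by
  have h' : e (PowerMod.mk J A) ≤ e (PowerMod.mk J B) := e.monotone (mk_le_mk.2 hAB)
  exact (Heyting.Regular.coe_le_coe.2 h') h

theorem Forces.mono (h : Forces e p A) (hAB : A ⊆ B) : Forces e p B :=
  h.of_diff_mem (by rw [sdiff_eq_empty.2 hAB]; exact empty_mem J)

theorem forces_compl_iff : Forces e p Aᶜ ↔ ∀ q ≤ p, ¬ Forces e q A := by
  have h : e (PowerMod.mk J Aᶜ) = (e (PowerMod.mk J A))ᶜ := map_compl' e (PowerMod.mk J A)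
  rw [Forces, h]
  exact mem_lowerSet_compl_iff

theorem forces_univ : Forces e p univ := by
  have h : e (PowerMod.mk J univ) = ⊤ := map_top e
  rw [Forces, h]
  exact LowerSet.mem_top

theorem not_forces_of_mem (h : A ∈ J) : ¬ Forces e p A := by
  intro hA
  have h' : e (PowerMod.mk J ∅) = ⊥ := map_bot e
  have hA' : Forces e p ∅ := hA.of_diff_mem (mem_of_subset sdiff_subset h)
  rw [Forces, h'] at hA'
  exact hA'

theorem forces_compl_of_mem (h : A ∈ J) : Forces e p Aᶜ :=
  forces_compl_iff.2 fun _ _ => not_forces_of_mem h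

theorem Forces.not_compl (h : Forces e p A) : ¬ Forces e p Aᶜ := fun h' =>
  forces_compl_iff.1 h' p le_rfl h

/-- The image of a condition `p` in the Boolean completion is the class of a set `Z`, the least set
modulo `J` that `p` forces; every condition that forces `Z` is compatible with `p`. -/
theorem exists_forces_compatible (e : PowerMod J ≃o BooleanCompletion P) (p : P) :
    ∃ Z : Set X, Forces e p Z ∧ (∀ q, Forces e q Z → ∃ r, r ≤ q ∧ r ≤ p) ∧
      ∀ A, Forces e p A → Z \ A ∈ J := by
  obtain ⟨z, hz⟩ := e.surjective (Heyting.Regular.toRegular (LowerSet.Iic p))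
  obtain ⟨Z, rfl⟩ : ∃ Z, PowerMod.mk J Z = z := Quotient.exists_rep z
  refine ⟨Z, ?_, fun q hq => ?_, fun A hA => ?_⟩
  · rw [Forces, hz]
    exact (le_compl_compl : LowerSet.Iic p ≤ _) (LowerSet.mem_Iic_iff.2 le_rfl)
  · rw [Forces, hz] at hq
    have hq' := mem_lowerSet_compl_iff.1 hq q le_rfl
    rw [mem_lowerSet_compl_iff] at hq'
    push Not at hq'
    obtain ⟨r, hr, hrp⟩ := hq'
    exact ⟨r, hr, LowerSet.mem_Iic_iff.1 hrp⟩
  · rw [← mk_le_mk, ← e.le_iff_le, hz]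
    exact (Heyting.Regular.gi.gc _ _).2 (LowerSet.Iic_le.2 hA)

/-- Completeness of `J` makes unions of fewer than `c` sets suprema in the quotient, so that a
condition forcing such a union can be strengthened to force one of the sets. -/
theorem Forces.exists_of_iUnion {c : Cardinal.{u}} (hJ : IsCompleteIdeal c J) {ι : Type u}
    (hι : #ι < c) {A : ι → Set X} (h : Forces e p (⋃ i, A i)) :
    ∃ q ≤ p, ∃ i, Forces e q (A i) := by
  by_contra! hcon
  obtain ⟨Z, hpZ, -, hZ⟩ := exists_forces_compatible e p
  have h₁ : ∀ i, Z ∩ A i ∈ J := fun i => by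
    have := hZ _ (forces_compl_iff.2 fun q hq => hcon q hq i)
    rwa [sdiff_compl] at this
  have h₂ : ⋃₀ range (fun i => Z ∩ A i) ∈ J :=
    hJ _ (mk_range_le.trans_lt hι) (by rintro _ ⟨i, rfl⟩; exact h₁ i)
  refine not_forces_of_mem (mem_of_subset (fun x hx => ?_) (union_mem h₂ (hZ _ h))) hpZ
  by_cases hxA : x ∈ ⋃ i, A i
  · obtain ⟨i, hi⟩ := mem_iUnion.1 hxA
    exact Or.inl ⟨_, ⟨i, rfl⟩, hx, hi⟩
  · exact Or.inr ⟨hx, hxA⟩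

theorem forces_iInter {c : Cardinal.{u}} (hJ : IsCompleteIdeal c J) {ι : Type u}
    (hι : #ι < c) {A : ι → Set X} (h : ∀ i, Forces e p (A i)) : Forces e p (⋂ i, A i) := by
  have : Forces e p (⋃ i, (A i)ᶜ)ᶜ := forces_compl_iff.2 fun q hq hqA => by
    obtain ⟨r, hr, i, hri⟩ := hqA.exists_of_iUnion hJ hι
    exact ((h i).of_le (hr.trans hq)).not_compl hri
  exact this.mono (by simp [compl_iUnion])

theorem Forces.inter (hA : Forces e p A) (hB : Forces e p B) : Forces e p (A ∩ B) := by
  have h : e (PowerMod.mk J (A ∩ B)) = e (PowerMod.mk J A) ⊓ e (PowerMod.mk J B) :=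
    e.map_inf (PowerMod.mk J A) (PowerMod.mk J B)
  rw [Forces, h]
  exact ⟨hA, hB⟩

theorem exists_le_forces_fiber {c : Cardinal.{u}} (hJ : IsCompleteIdeal c J) {M : Type u}
    (hM : #M < c) (e : PowerMod J ≃o BooleanCompletion P) (h : X → M) (p : P) :
    ∃ q ≤ p, ∃ m, Forces e q {x | h x = m} := by
  refine Forces.exists_of_iUnion hJ hM (forces_univ.mono fun x _ => ?_)
  exact mem_iUnion.2 ⟨h x, rfl⟩

end Forcing

/-! ### Lower bounds in the collapse -/

namespace Col

variable {κ lam : Cardinal.{u}}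

/-- Two conditions agree if their union is a function, that is, if they are compatible. -/
def Agree (p q : Col κ lam) : Prop :=
  ∀ a b b', b ∈ p.toPFun a → b' ∈ q.toPFun a → b = b'

theorem agree_of_le {p q r : Col κ lam} (hp : r ≤ p) (hq : r ≤ q) : Agree p q :=
  fun a _ _ hb hb' => Part.mem_unique (hp a _ hb) (hq a _ hb')

theorem agree_of_le_or_le {p q : Col κ lam} (h : p ≤ q ∨ q ≤ p) : Agree p q :=
  h.elim (fun h => agree_of_le le_rfl h) fun h => agree_of_le h le_rfl

/-- Fewer than `κ` many pairwise compatible conditions have a common lower bound, their union. -/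
theorem exists_le_of_agree (hκ : κ.IsRegular) {ι : Type u} (hι : #ι < κ) (p : ι → Col κ lam)
    (h : ∀ i j, Agree (p i) (p j)) :
    ∃ q : Col κ lam, (∀ i, q ≤ p i) ∧
      ∀ a b, b ∈ q.toPFun a → ∃ i, b ∈ (p i).toPFun a := by
  let f : Below κ →. Below lam := fun a =>
    ⟨∃ b i, b ∈ (p i).toPFun a, fun h => h.choose⟩
  have hf : f.Dom ⊆ ⋃ i, (p i).toPFun.Dom := by
    rintro a ⟨b, i, hb⟩
    exact mem_iUnion.2 ⟨i, Part.dom_iff_mem.2 ⟨b, hb⟩⟩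
  refine ⟨⟨f, (mk_le_mk_of_subset hf).trans_lt
    ((card_iUnion_lt_iff_forall_of_isRegular hκ hι).2 fun i => (p i).card_dom_lt)⟩,
    fun i a b hb => ?_, fun a b hb => ?_⟩
  · have hd : ∃ b i, b ∈ (p i).toPFun a := ⟨b, i, hb⟩
    obtain ⟨j, hj⟩ := hd.choose_spec
    exact ⟨hd, h j i a _ _ hj hb⟩
  · obtain ⟨hd, rfl⟩ := hb
    exact hd.choose_spec

/-- Sequences of conditions modulo bounded sets have lower bounds: if the coordinates of any two
of at most `κ` many `κ`-sequences of conditions are eventually compatible, then some sequence is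
eventually below each of them. -/
theorem exists_eventually_le (hκ : κ.IsRegular) {ι : Type u} (hι : #ι ≤ κ)
    (p : ι → Below κ → Col κ lam)
    (h : ∀ i j, ∀ᶠ α in Filter.atTop, Agree (p i α) (p j α)) :
    ∃ q : Below κ → Col κ lam, (∀ i, ∀ᶠ α in Filter.atTop, q α ≤ p i α) ∧
      ∀ α a b, b ∈ (q α).toPFun a → ∃ i, b ∈ (p i α).toPFun a := by
  obtain ⟨c⟩ : Nonempty (ι ↪ Below κ) := by rwa [← Cardinal.le_def, mk_ord_toType]
  -- The indices used at coordinate `α`: those below `α` whose conditions are compatible with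
  -- all those of smaller index. Any two of them are compatible at `α`.
  let T : Below κ → Set ι := fun α => {i | c i ≤ α ∧ ∀ j, c j ≤ c i → Agree (p j α) (p i α)}
  have hmk : ∀ b, #{j | c j ≤ b} < κ := fun b => by
    refine lt_of_le_of_lt ?_ (mk_Iic_below_lt hκ b)
    exact mk_le_of_injective (f := fun j : {j | c j ≤ b} => (⟨c j, j.2⟩ : Iic b))
      fun i j hij => Subtype.ext (c.injective (congrArg Subtype.val hij))
  have hT : ∀ α, #(T α) < κ := fun α =>
    (mk_le_mk_of_subset fun i hi => hi.1).trans_lt (hmk α)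
  have hagree : ∀ α (i j : T α), Agree (p i α) (p j α) := fun α i j => by
    rcases le_total (c i) (c j) with hij | hij
    · exact j.2.2 i hij
    · exact fun a b b' hb hb' => (i.2.2 j hij a b' b hb' hb).symm
  choose q hq hq' using fun α => exists_le_of_agree hκ (hT α) (fun i : T α => p i α) (hagree α)
  refine ⟨q, fun i => ?_, fun α a b hb => ?_⟩
  · have := eventually_forall hκ (hmk (c i)) fun j => h j i
    filter_upwards [this, Filter.eventually_ge_atTop (c i)] with α hα hα'
    exact hq α ⟨i, hα', fun j hj => hα ⟨j, hj⟩⟩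
  · obtain ⟨i, hi⟩ := hq' α a b hb
    exact ⟨i, hi⟩

/-- Distributivity: fewer than `κ` many open dense sets have a dense intersection. -/
theorem exists_le_forall_mem (hκ : κ.IsRegular) {ι : Type u} (hι : #ι < κ)
    (D : ι → Set (Col κ lam)) (hopen : ∀ i, IsLowerSet (D i))
    (hdense : ∀ i p, ∃ q ≤ p, q ∈ D i) (p : Col κ lam) : ∃ q ≤ p, ∀ i, q ∈ D i := by
  obtain ⟨w⟩ : Nonempty (Below #ι ≃ ι) := Cardinal.eq.1 (mk_ord_toType _)
  have hlb : ∀ (A : Set (Below #ι)) (s : Below #ι → Col κ lam), (∀ v ∈ A, s v ≤ p) →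
      (∀ u ∈ A, ∀ v ∈ A, u < v → s v ≤ s u) → ∃ q ≤ p, ∀ v ∈ A, q ≤ s v := by
    intro A s hp hs
    have hA : #(Option A) < κ := by
      rw [mk_option]
      refine add_lt_of_lt hκ.aleph0_le ((mk_set_le A).trans_lt ?_) (by simpa using hκ.nat_lt 1)
      rwa [mk_ord_toType]
    obtain ⟨q, hq, -⟩ := exists_le_of_agree hκ hA
      (fun o : Option A => o.elim p fun v => s v) (by
        rintro (_ | u) (_ | v) <;> apply agree_of_le_or_le
        · exact Or.inl le_rfl
        · exact Or.inr (hp v v.2)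
        · exact Or.inl (hp u u.2)
        · rcases lt_trichotomy u v with h | h | h
          · exact Or.inr (hs u u.2 v v.2 h)
          · exact Or.inl (h ▸ le_rfl)
          · exact Or.inl (hs v v.2 u u.2 h))
    exact ⟨q, hq none, fun v hv => hq (some ⟨v, hv⟩)⟩
  have : Nonempty (Col κ lam) := ⟨p⟩
  obtain ⟨s, hs⟩ := exists_seq_of_forall_exists
    (fun (v : Below #ι) s q => q ≤ p ∧ (∀ u < v, q ≤ s u) ∧ q ∈ D (w v))
    (fun v s s' q h hq => ⟨hq.1, fun u hu => h u hu ▸ hq.2.1 u hu, hq.2.2⟩)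
    (fun v s h => by
      obtain ⟨q, hqp, hq⟩ := hlb (Iio v) s (fun u hu => (h u hu).1)
        fun u _ u' hu' huu' => (h u' hu').2.1 u huu'
      obtain ⟨r, hr, hrD⟩ := hdense (w v) q
      exact ⟨r, hr.trans hqp, fun u hu => hr.trans (hq u hu), hrD⟩)
  obtain ⟨q, hqp, hq⟩ := hlb univ s (fun v _ => (hs v).1) fun u _ v _ huv => (hs v).2.1 u huv
  refine ⟨q, hqp, fun i => ?_⟩
  have := hopen _ (hq (w.symm i) trivial) (hs (w.symm i)).2.2
  rwa [w.apply_symm_apply] at this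

/-! ### Conditions with bounded range -/

/-- The conditions all of whose values are below `γ`. -/
def below (κ : Cardinal.{u}) {lam : Cardinal.{u}} (γ : Below lam) : Set (Col κ lam) :=
  {p | ∀ a, ∀ b ∈ p.toPFun a, b < γ}

theorem below_mono {γ δ : Below lam} (h : γ ≤ δ) : below κ γ ⊆ below κ δ :=
  fun _ hp a b hb => (hp a b hb).trans_le h

theorem mk_range_lt (p : Col κ lam) : #{b | ∃ a, b ∈ p.toPFun a} < κ := by
  refine lt_of_le_of_lt ?_ p.card_dom_lt
  refine mk_le_of_surjective (f := fun a : p.toPFun.Dom =>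
    (⟨(p.toPFun a).get a.2, a, Part.get_mem _⟩ : {b | ∃ a, b ∈ p.toPFun a})) ?_
  rintro ⟨b, a, hb⟩
  exact ⟨⟨a, Part.dom_iff_mem.2 ⟨b, hb⟩⟩, Subtype.ext (Part.get_eq_of_mem hb _)⟩

theorem exists_mem_below (hl : lam.IsRegular) (h : κ ≤ lam) (p : Col κ lam) :
    ∃ γ, p ∈ below κ γ := by
  obtain ⟨γ, hγ⟩ := exists_forall_lt hl (p.mk_range_lt.trans_le h) fun b => (b : Below lam)
  exact ⟨γ, fun a b hb => hγ ⟨b, a, hb⟩⟩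

/-- At a point `γ` of cofinality `κ`, the conditions with values below `γ` have values bounded
below `γ`. -/
theorem exists_lt_mem_below {γ : Below lam} (hγ : Order.cof (Iio γ) = κ) {p : Col κ lam}
    (hp : p ∈ below κ γ) : ∃ δ < γ, p ∈ below κ δ := by
  let A : Set (Iio γ) := {b | ∃ a, (b : Below lam) ∈ p.toPFun a}
  have hA : ¬ IsCofinal A := fun h => by
    have hle := Order.cof_le h
    rw [hγ] at hle
    refine (hle.trans ?_).not_gt p.mk_range_lt
    exact mk_le_of_injective (f := fun b : A => (⟨b.1, b.2⟩ : {b | ∃ a, b ∈ p.toPFun a}))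
      fun b b' hb => Subtype.ext (Subtype.ext (Subtype.mk.inj hb))
  rw [IsCofinal] at hA
  push Not at hA
  obtain ⟨δ, hδ⟩ := hA
  exact ⟨δ, δ.2, fun a b hb => hδ ⟨b, hp a b hb⟩ ⟨a, hb⟩⟩

theorem mk_below_le (hκ : κ.IsRegular)
    (hpow : ∀ M : Type u, #M < κ → #(M → Below κ) ≤ κ) (γ : Below (succ κ)) :
    #(below κ γ) ≤ κ := by
  classical
  have hγ : #(Option (Iio γ)) ≤ #(Below κ) := by
    have : #(Iio γ) < succ κ := by simpa using mk_Iio_lt γ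
    rw [mk_option, mk_ord_toType]
    exact add_le_of_le hκ.aleph0_le (lt_succ_iff.1 this) (one_le_aleph0.trans hκ.aleph0_le)
  have hdom : ∀ p : Col κ (succ κ), ∃ a, ∀ x ∈ p.toPFun.Dom, x < a := fun p => by
    obtain ⟨a, ha⟩ := exists_forall_lt hκ p.card_dom_lt fun x => (x : Below κ)
    exact ⟨a, fun x hx => ha ⟨x, hx⟩⟩
  choose d hd using hdom
  let f : below κ γ → Σ a : Below κ, (Iio a → Option (Iio γ)) := fun p =>
    ⟨d p, fun x => if h : (p.1.toPFun x).Dom then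
      some ⟨(p.1.toPFun x).get h, p.2 x _ (Part.get_mem h)⟩ else none⟩
  have hf_apply : ∀ p x b, (f p).2 x = some b ↔ (b : Below (succ κ)) ∈ p.1.toPFun x := by
    intro p x b
    change (if h : (p.1.toPFun x).Dom then _ else none) = some b ↔ _
    by_cases hD : (p.1.toPFun x).Dom
    · rw [dif_pos hD, Option.some.injEq, Subtype.ext_iff]
      exact Part.get_eq_iff_mem hD
    · rw [dif_neg hD]
      exact ⟨fun h => (Option.some_ne_none _ h.symm).elim,
        fun h => (hD (Part.dom_iff_mem.2 ⟨_, h⟩)).elim⟩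
  -- A condition is determined by its restriction to an initial segment containing its domain.
  have hf : ∀ p q, f p = f q → p.1 ≤ q.1 := by
    intro p q hpq a b hb
    have haq : a < (f q).1 := hd _ _ (Part.dom_iff_mem.2 ⟨b, hb⟩)
    have h := (hf_apply q ⟨a, haq⟩ ⟨b, q.2 a b hb⟩).2 hb
    have hgen : ∀ z : Σ a : Below κ, (Iio a → Option (Iio γ)), z = f q →
        ∃ h : a < z.1, z.2 ⟨a, h⟩ = some ⟨b, q.2 a b hb⟩ := by
      rintro _ rfl
      exact ⟨haq, h⟩
    obtain ⟨_, h'⟩ := hgen _ hpq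
    exact (hf_apply p _ _).1 h'
  calc #(below κ γ) ≤ #(Σ a : Below κ, (Iio a → Option (Iio γ))) :=
        mk_le_of_injective (f := f) fun p q h =>
          Subtype.ext (le_antisymm (hf p q h) (hf q p h.symm))
    _ ≤ sum fun _ : Below κ => κ := by
        rw [mk_sigma]
        refine sum_le_sum _ _ fun a => ?_
        have ha : #(Iio a) < κ := by simpa using mk_Iio_lt a
        refine le_trans ?_ (hpow _ ha)
        simpa only [mk_pi, prod_const, Cardinal.lift_id] using power_le_power_right hγ
    _ = κ := by rw [sum_const', mk_ord_toType, mul_eq_self hκ.aleph0_le]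

theorem mk_le_succ (hκ : κ.IsRegular)
    (hpow : ∀ M : Type u, #M < κ → #(M → Below κ) ≤ κ) : #(Col κ (succ κ)) ≤ succ κ := by
  have hs := isRegular_succ hκ.aleph0_le
  have h : (⋃ γ, below κ γ) = (univ : Set (Col κ (succ κ))) :=
    eq_univ_of_forall fun p => mem_iUnion.2 (exists_mem_below hs (le_succ κ) p)
  rw [← mk_univ, ← h]
  refine (mk_iUnion_le_sum_mk).trans ((sum_le_sum _ (fun _ => succ κ) fun γ =>
    (mk_below_le hκ hpow γ).trans (le_succ κ)).trans ?_)
  rw [sum_const', mk_ord_toType, mul_eq_self hs.aleph0_le]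

end Col

/-! ### Cardinal arithmetic from the ideal -/

/-- If the quotient by `J` is the completion of the collapse, then `κ^{<κ} = κ`. Otherwise `κ⁺`
many distinct functions `x i` from some `M` of size less than `κ` to `κ` exist. By distributivity,
some condition decides all values of the function with generic index, so that almost all `x i`,
for `i` in a `J`-positive set, are equal. -/
theorem mk_fun_le {κ : Cardinal.{u}} (hκ : κ.IsRegular) {J : Order.Ideal (Set (Below (succ κ)))}
    (hJ : IsNormalIdeal J) (e : PowerMod J ≃o BooleanCompletion (Col κ (succ κ)))
    (M : Type u) (hM : #M < κ) : #(M → Below κ) ≤ κ := by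
  by_contra! hcon
  obtain ⟨x⟩ : Nonempty (Below (succ κ) ↪ (M → Below κ)) := by
    rw [← Cardinal.le_def, mk_ord_toType]
    exact succ_le_of_lt hcon
  have hκM : #(Below κ) < succ κ := by simp
  let p : Col κ (succ κ) := ⟨fun _ => Part.none, by
    simpa [PFun.Dom] using hκ.pos⟩
  obtain ⟨q, -, hq⟩ := Col.exists_le_forall_mem hκ hM
    (fun m => {p | ∃ ξ, Forces e p {i | x i m = ξ}})
    (fun m p p' hp => fun ⟨ξ, hξ⟩ => ⟨ξ, hξ.of_le hp⟩)
    (fun m p => exists_le_forces_fiber hJ.complete hκM e (fun i => x i m) p) p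
  choose y hy using hq
  refine not_forces_of_mem ?_ (forces_iInter hJ.complete (hM.trans (lt_succ κ)) hy)
  by_cases h : ∃ i, x i = y
  · obtain ⟨i, rfl⟩ := h
    refine mem_of_subset (fun j hj => ?_) (hJ.singleton_mem i)
    exact x.injective (funext fun m => mem_iInter.1 hj m)
  · refine mem_of_subset (fun j hj => h ⟨j, ?_⟩) (empty_mem J)
    exact funext fun m => mem_iInter.1 hj m

/-! ### The tower -/

/-- A tower of `κ`-sequences of conditions in `Col(κ, κ⁺)`: it has length `κ⁺`, it is descending
modulo bounded sets, its members are eventually below the sequence `p₀`, and every dense subset of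
the collapse contains all terms of some member. -/
structure IsTower {κ : Cardinal.{u}} (p₀ : Below κ → Col κ (succ κ))
    (s : Below (succ κ) → Below κ → Col κ (succ κ)) : Prop where
  le_base : ∀ γ, ∀ᶠ α in Filter.atTop, s γ α ≤ p₀ α
  le_of_le : ∀ δ γ, δ ≤ γ → ∀ᶠ α in Filter.atTop, s γ α ≤ s δ α
  meets : ∀ D : Set (Col κ (succ κ)), (∀ p, ∃ q ≤ p, q ∈ D) → ∃ γ, ∀ α, s γ α ∈ D

/-- The diamond principle yields a tower. The conditions are coded injectively by points of `κ⁺`.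
At stage `γ`, if the guess `d γ` codes a set of conditions that is dense among those with values
below `γ`, then the terms of the new sequence are taken from that set. A dense set is guessed
correctly at some point of cofinality `κ` that is closed under a function bounding extensions
into the dense set and their codes; at such points the guess is indeed dense. -/
theorem exists_isTower {κ : Cardinal.{u}} (hκ : κ.IsRegular)
    (hpow : ∀ M : Type u, #M < κ → #(M → Below κ) ≤ κ)
    (hdiamond : Diamond (succ κ) (cofPoints (succ κ) κ))
    (p₀ : Below κ → Col κ (succ κ)) (c₀ : Below (succ κ)) (hp₀ : ∀ α, p₀ α ∈ Col.below κ c₀) :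
    ∃ s, IsTower p₀ s := by
  have hs := isRegular_succ hκ.aleph0_le
  have := nonempty_below hκ
  obtain ⟨code⟩ : Nonempty (Col κ (succ κ) ↪ Below (succ κ)) := by
    rw [← Cardinal.le_def, mk_ord_toType]
    exact Col.mk_le_succ hκ hpow
  obtain ⟨d, hd⟩ := hdiamond
  -- Values below `c₀` are always allowed, to make room for the terms of `p₀`.
  let B : Below (succ κ) → Set (Col κ (succ κ)) := fun γ => Col.below κ (max γ c₀)
  have hB : ∀ {γ δ}, γ ≤ δ → B γ ⊆ B δ := fun h => Col.below_mono (max_le_max_right _ h)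
  let Guess : Below (succ κ) → Prop := fun γ =>
    ∀ p ∈ B γ, ∃ q ≤ p, q ∈ B γ ∧ code q ∈ d γ
  have hmk : ∀ γ : Below (succ κ), #(Option (Iio γ)) ≤ κ := fun γ => by
    have : #(Iio γ) < succ κ := by simpa using mk_Iio_lt γ
    rw [mk_option]
    exact add_le_of_le hκ.aleph0_le (lt_succ_iff.1 this) (one_le_aleph0.trans hκ.aleph0_le)
  have : Nonempty (Below κ → Col κ (succ κ)) := ⟨p₀⟩
  obtain ⟨s, hS⟩ := exists_seq_of_forall_exists
    (fun (γ : Below (succ κ)) s (q : Below κ → Col κ (succ κ)) =>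
      (∀ᶠ α in Filter.atTop, q α ≤ p₀ α) ∧
      (∀ δ < γ, ∀ᶠ α in Filter.atTop, q α ≤ s δ α) ∧
      (∀ α, q α ∈ B γ) ∧ (Guess γ → ∀ α, code (q α) ∈ d γ))
    (fun γ s s' q h hq => ⟨hq.1, fun δ hδ => h δ hδ ▸ hq.2.1 δ hδ, hq.2.2⟩)
    (fun γ s h => by
      obtain ⟨q, hq, hq'⟩ := Col.exists_eventually_le hκ (hmk γ)
        (fun o : Option (Iio γ) => o.elim p₀ fun δ => s δ) (by
          rintro (_ | δ) (_ | ε)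
          · exact Filter.Eventually.of_forall fun α => Col.agree_of_le le_rfl le_rfl
          · exact (h ε ε.2).1.mono fun α hα => Col.agree_of_le_or_le (Or.inr hα)
          · exact (h δ δ.2).1.mono fun α hα => Col.agree_of_le_or_le (Or.inl hα)
          · rcases lt_trichotomy δ ε with hlt | rfl | hlt
            · exact ((h ε ε.2).2.1 δ hlt).mono fun α hα => Col.agree_of_le_or_le (Or.inr hα)
            · exact Filter.Eventually.of_forall fun α => Col.agree_of_le le_rfl le_rfl
            · exact ((h δ δ.2).2.1 ε hlt).mono fun α hα => Col.agree_of_le_or_le (Or.inl hα))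
      have hqB : ∀ α, q α ∈ B γ := by
        intro α a b hb
        obtain ⟨_ | δ, hi⟩ := hq' α a b hb
        · exact (hp₀ α a b hi).trans_le (le_max_right _ _)
        · exact hB δ.2.le ((h δ δ.2).2.2.1 α) a b hi
      have hr : ∃ r : Below κ → Col κ (succ κ), (∀ α, r α ≤ q α) ∧ (∀ α, r α ∈ B γ) ∧
          (Guess γ → ∀ α, code (r α) ∈ d γ) := by
        by_cases hg : Guess γ
        · choose r hr hrB hrd using fun α => hg (q α) (hqB α)
          exact ⟨r, hr, hrB, fun _ => hrd⟩
        · exact ⟨q, fun _ => le_rfl, hqB, fun h => (hg h).elim⟩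
      obtain ⟨r, hr, hrB, hrd⟩ := hr
      exact ⟨r, (hq none).mono fun α hα => (hr α).trans hα,
        fun δ hδ => (hq (some ⟨δ, hδ⟩)).mono fun α hα => (hr α).trans hα, hrB, hrd⟩)
  refine ⟨s, fun γ => (hS γ).1, fun δ γ h => ?_, fun D hD => ?_⟩
  · rcases h.lt_or_eq with h | rfl
    · exact (hS γ).2.1 δ h
    · exact Filter.Eventually.of_forall fun α => le_rfl
  · choose r hr hrD using hD
    have hρ : ∀ p, ∃ δ, r p ∈ Col.below κ δ ∧ code (r p) < δ := fun p => by
      obtain ⟨δ, hδ⟩ := Col.exists_mem_below hs (le_succ κ) (r p)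
      obtain ⟨δ', hδ'⟩ := exists_forall_lt hs (ι := PUnit)
        (by simpa using hs.nat_lt 1) fun _ => code (r p)
      exact ⟨max δ δ', Col.below_mono (le_max_left _ _) hδ,
        (hδ' ⟨⟩).trans_le (le_max_right _ _)⟩
    choose ρ hρ hρ' using hρ
    have hf : ∀ γ, ∃ δ, c₀ ≤ δ ∧ ∀ p ∈ Col.below κ γ, ρ p ≤ δ := fun γ => by
      obtain ⟨δ, hδ⟩ := exists_forall_lt hs
        ((Col.mk_below_le hκ hpow γ).trans_lt (lt_succ κ)) fun p => ρ p
      exact ⟨max c₀ δ, le_max_left _ _, fun p hp =>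
        (hδ ⟨p, hp⟩).le.trans (le_max_right _ _)⟩
    choose f hf₀ hf using hf
    obtain ⟨γ, ⟨hγ, hdγ⟩, hclub⟩ := hd (code '' D)
      (isClub_closurePoints hs (hκ.aleph0_le.trans_lt (lt_succ κ)) f)
    have hγ : Order.cof (Iio γ) = κ := hγ
    have hne : (Iio γ).Nonempty := by
      rw [← nonempty_coe_sort, ← cof_ne_zero_iff, hγ]
      exact hκ.pos.ne'
    obtain ⟨δ₀, hδ₀⟩ := hne
    have hmax : max γ c₀ = γ := max_eq_left ((hf₀ δ₀).trans (hclub δ₀ hδ₀))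
    have hguess : Guess γ := by
      intro p hp
      simp only [B, hmax] at hp ⊢
      obtain ⟨δ, hδ, hpδ⟩ := Col.exists_lt_mem_below hγ hp
      have hργ : ρ p ≤ γ := (hf δ p hpδ).trans (hclub δ hδ)
      refine ⟨r p, hr p, Col.below_mono hργ (hρ p), ?_⟩
      rw [← hdγ]
      exact ⟨mem_image_of_mem _ (hrD p), (hρ' p).trans_le hργ⟩
    refine ⟨γ, fun α => ?_⟩
    have hcode := (hS γ).2.2.2 hguess α
    rw [← hdγ] at hcode
    exact (code.injective.mem_set_image).1 hcode.1

/-! ### The antichain and its projection -/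

/-- A `κ`-sequence of pairwise incompatible conditions of bounded range. -/
theorem exists_antichain {κ : Cardinal.{u}} (hκ : κ.IsRegular) :
    ∃ (p₀ : Below κ → Col κ (succ κ)) (c₀ : Below (succ κ)),
      (∀ α, p₀ α ∈ Col.below κ c₀) ∧ ∀ α β, Col.Agree (p₀ α) (p₀ β) → α = β := by
  obtain ⟨a₀⟩ := nonempty_below hκ
  obtain ⟨i⟩ : Nonempty (Below κ ↪ Below (succ κ)) := by
    rw [← Cardinal.le_def, mk_ord_toType, mk_ord_toType]
    exact le_succ κ
  obtain ⟨c₀, hc₀⟩ := exists_forall_lt (isRegular_succ hκ.aleph0_le)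
    (by simp : #(Below κ) < succ κ) i
  let p₀ : Below κ → Col κ (succ κ) := fun α =>
    { toPFun := fun a => ⟨a = a₀, fun _ => i α⟩
      card_dom_lt := by
        have : (PFun.Dom fun a => (⟨a = a₀, fun _ => i α⟩ : Part (Below (succ κ)))) = {a₀} := rfl
        rw [this, mk_singleton]
        simpa using hκ.nat_lt 1 }
  refine ⟨p₀, c₀, ?_, fun α β h => i.injective (h a₀ _ _ ⟨rfl, rfl⟩ ⟨rfl, rfl⟩)⟩
  rintro α a b ⟨-, rfl⟩
  exact hc₀ α

/-- An antichain of size `κ` is realized by a partition of the underlying set, by completeness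
of `J`. -/
theorem exists_projection {κ : Cardinal.{u}} (hκ : κ.IsRegular) {X P : Type u} [PartialOrder P]
    {J : Order.Ideal (Set X)} (hJ : IsCompleteIdeal (succ κ) J)
    (e : PowerMod J ≃o BooleanCompletion P) (p₀ : Below κ → P)
    (hp₀ : ∀ α β r, r ≤ p₀ α → r ≤ p₀ β → α = β) :
    ∃ π : X → Below κ, ∀ α, Forces e (p₀ α) (π ⁻¹' {α}) := by
  classical
  obtain ⟨a₀⟩ := nonempty_below hκ
  choose Z hZ hZ' _ using fun α => exists_forces_compatible e (p₀ α)
  refine ⟨fun x => if h : ∃ α, x ∈ Z α then h.choose else a₀, fun α => ?_⟩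
  have h₁ : Forces e (p₀ α) (⋂ β : {β // β ≠ α}, (Z β)ᶜ) := by
    refine forces_iInter hJ ((mk_subtype_le _).trans_lt (by simp)) fun β => ?_
    refine forces_compl_iff.2 fun q hq hqZ => ?_
    obtain ⟨r, hr, hrβ⟩ := hZ' β q hqZ
    exact β.2 (hp₀ _ _ r hrβ (hr.trans hq))
  refine ((hZ α).inter h₁).mono fun x hx => ?_
  have hex : ∃ α, x ∈ Z α := ⟨α, hx.1⟩
  simp only [mem_preimage, hex, ↓reduceDIte, mem_singleton_iff]
  by_contra hne
  exact mem_iInter.1 hx.2 ⟨_, hne⟩ hex.choose_spec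

/-! ### The ideal of a tower -/

section TowerIdeal

variable {κ : Cardinal.{u}} {X : Type u} {J : Order.Ideal (Set X)}
  {e : PowerMod J ≃o BooleanCompletion (Col κ (succ κ))}
  {p₀ : Below κ → Col κ (succ κ)} {s : Below (succ κ) → Below κ → Col κ (succ κ)}

/-- The ideal of all sets whose complement is forced by almost all terms of some member of the
tower. -/
def towerIdeal (hκ : κ.IsRegular) (e : PowerMod J ≃o BooleanCompletion (Col κ (succ κ)))
    (hs : IsTower p₀ s) : Order.Ideal (Set X) where
  carrier := {A | ∃ γ, ∀ᶠ α in Filter.atTop, Forces e (s γ α) Aᶜ}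
  lower' := fun _ _ h ⟨γ, hγ⟩ => ⟨γ, hγ.mono fun _ hα => hα.mono (compl_subset_compl.2 h)⟩
  nonempty' := by
    obtain ⟨γ⟩ := nonempty_below (isRegular_succ hκ.aleph0_le)
    exact ⟨∅, γ, Filter.Eventually.of_forall fun α => by
      rw [compl_empty]
      exact forces_univ⟩
  directed' := by
    rintro A ⟨γ, hγ⟩ B ⟨δ, hδ⟩
    refine ⟨A ∪ B, ⟨max γ δ, ?_⟩, subset_union_left, subset_union_right⟩
    filter_upwards [hγ, hδ, hs.le_of_le _ _ (le_max_left γ δ),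
      hs.le_of_le _ _ (le_max_right γ δ)] with α h₁ h₂ h₃ h₄
    rw [compl_union]
    exact (h₁.of_le h₃).inter (h₂.of_le h₄)

variable {hκ : κ.IsRegular} {hs : IsTower p₀ s}

theorem mem_towerIdeal {A : Set X} :
    A ∈ towerIdeal hκ e hs ↔ ∃ γ, ∀ᶠ α in Filter.atTop, Forces e (s γ α) Aᶜ :=
  Iff.rfl

theorem le_towerIdeal : J ≤ towerIdeal hκ e hs := fun _ hA => by
  obtain ⟨γ⟩ := nonempty_below (isRegular_succ hκ.aleph0_le)
  exact ⟨γ, Filter.Eventually.of_forall fun α => forces_compl_of_mem hA⟩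

theorem isCompleteIdeal_towerIdeal (hJ : IsCompleteIdeal (succ κ) J) :
    IsCompleteIdeal κ (towerIdeal hκ e hs) := by
  intro S hS hSK
  -- Regularity of `κ⁺` gives a common stage, regularity of `κ` a common bound on the exceptions.
  choose γ hγ using fun A : S => mem_towerIdeal.1 (hSK A A.2)
  have hS' : #S < succ κ := hS.trans (lt_succ κ)
  obtain ⟨δ, hδ⟩ := exists_forall_lt (isRegular_succ hκ.aleph0_le) hS' γ
  refine mem_towerIdeal.2 ⟨δ, ?_⟩
  filter_upwards [eventually_forall hκ hS hγ,
    eventually_forall hκ hS fun A => hs.le_of_le _ _ (hδ A).le] with α h₁ h₂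
  have h := forces_iInter hJ hS' fun A => (h₁ A).of_le (h₂ A)
  rwa [sUnion_eq_iUnion, compl_iUnion]

theorem preimage_mem_towerIdeal_iff {π : X → Below κ}
    (hπ : ∀ α, Forces e (p₀ α) (π ⁻¹' {α})) {A : Set (Below κ)} :
    π ⁻¹' A ∈ towerIdeal hκ e hs ↔ A ∈ bd hκ := by
  have := nonempty_below hκ
  constructor
  · rintro ⟨γ, hγ⟩
    obtain ⟨β, hβ⟩ := Filter.eventually_atTop.1 (hγ.and (hs.le_base γ))
    refine ⟨β, fun α hα => ?_⟩
    by_contra! hlt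
    obtain ⟨h₁, h₂⟩ := hβ α hlt.le
    refine Forces.not_compl (((hπ α).of_le h₂).mono ?_) h₁
    rintro x rfl
    exact hα
  · rintro ⟨β, hβ⟩
    obtain ⟨β', hβ'⟩ := exists_forall_lt hκ (ι := PUnit) (by simpa using hκ.nat_lt 1) fun _ => β
    obtain ⟨γ⟩ := nonempty_below (isRegular_succ hκ.aleph0_le)
    refine mem_towerIdeal.2 ⟨γ, ?_⟩
    filter_upwards [hs.le_base γ, Filter.eventually_ge_atTop β'] with α h₁ h₂
    refine ((hπ α).of_le h₁).mono ?_
    rintro x rfl hx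
    exact ((hβ hx).trans_lt (hβ' ⟨⟩)).not_ge h₂

/-- Modulo the ideal of the tower, every function into a set of size at most `κ` factors through
the projection: almost all terms of some member of the tower decide its value. -/
theorem exists_comp_eq_mod_towerIdeal (hJ : IsCompleteIdeal (succ κ) J)
    {π : X → Below κ} (hπ : ∀ α, Forces e (p₀ α) (π ⁻¹' {α})) {M : Type u} (hM : #M ≤ κ)
    (h : X → M) : ∃ f : Below κ → M, {x | f (π x) ≠ h x} ∈ towerIdeal hκ e hs := by
  obtain ⟨γ, hγ⟩ := hs.meets {p | ∃ m, Forces e p {x | h x = m}}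
    (exists_le_forces_fiber hJ (lt_succ_of_le hM) e h)
  choose f hf using hγ
  refine ⟨f, mem_towerIdeal.2 ⟨γ, (hs.le_base γ).mono fun α hα => ?_⟩⟩
  refine (((hπ α).of_le hα).inter (hf α)).mono ?_
  rintro x ⟨rfl, hx⟩ hne
  exact hne hx.symm

end TowerIdeal

/-! ### Quotients and reduced powers under a projection -/

section Projection

variable {X Y : Type u} {I : Order.Ideal (Set Y)} {K : Order.Ideal (Set X)} {π : X → Y}

theorem exists_powerMod_orderIso (hπ : ∀ A, π ⁻¹' A ∈ K ↔ A ∈ I)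
    (hsurj : ∀ B : Set X, ∃ A, PowerMod.mk K (π ⁻¹' A) = PowerMod.mk K B) :
    ∃ e : PowerMod I ≃o PowerMod K, ∀ A, e (PowerMod.mk I A) = PowerMod.mk K (π ⁻¹' A) := by
  let F : PowerMod I → PowerMod K := Quotient.map (sa := modSetoid I) (sb := modSetoid K)
    (π ⁻¹' ·) fun A B h => (hπ ((A \ B) ∪ (B \ A))).2 h
  have hle : ∀ a b, F a ≤ F b ↔ a ≤ b := by
    rintro ⟨A⟩ ⟨B⟩
    exact hπ (A \ B)
  have hF : Function.Surjective F := by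
    rintro ⟨B⟩
    obtain ⟨A, hA⟩ := hsurj B
    exact ⟨PowerMod.mk I A, hA⟩
  exact ⟨RelIso.ofSurjective (OrderEmbedding.ofMapLEIff F hle) hF, fun A => rfl⟩

theorem exists_reducedPower_equiv (hπ : ∀ A, π ⁻¹' A ∈ K ↔ A ∈ I) {M : Type u}
    (hsurj : ∀ h : X → M, ∃ f : Y → M, {x | f (π x) ≠ h x} ∈ K) :
    ∃ e : ReducedPower I M ≃ ReducedPower K M,
      ∀ f : Y → M, e (ReducedPower.mk I f) = ReducedPower.mk K (f ∘ π) := by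
  let F : ReducedPower I M → ReducedPower K M :=
    Quotient.map (sa := funSetoid I M) (sb := funSetoid K M)
      (· ∘ π) fun f g h => (hπ {y | f y ≠ g y}).2 h
  have hF : Function.Bijective F := by
    constructor
    · rintro ⟨f⟩ ⟨g⟩ h
      exact Quotient.sound (s := funSetoid I M)
        ((hπ {y | f y ≠ g y}).1 (Quotient.exact (s := funSetoid K M) h))
    · rintro ⟨h⟩
      obtain ⟨f, hf⟩ := hsurj h
      exact ⟨ReducedPower.mk I f, Quotient.sound (s := funSetoid K M) hf⟩
  exact ⟨Equiv.ofBijective F hF, fun f => rfl⟩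

end Projection

end BooleanTransfer

open BooleanTransfer
theorem mainTheorem6 (κ : Cardinal.{u}) (hκ : κ.IsRegular)
    (J : Order.Ideal (Set (Below (Order.succ κ)))) (hJ : IsNormalIdeal J)
    (hJcol : Nonempty (PowerMod J ≃o BooleanCompletion (Col κ (Order.succ κ))))
    (hdiamond : Diamond (Order.succ κ) (cofPoints (Order.succ κ) κ)) :
    ∃ (K : Order.Ideal (Set (Below (Order.succ κ)))) (π : Below (Order.succ κ) → Below κ),
      K.IsProper ∧ IsCompleteIdeal κ K ∧ J ≤ K ∧
      (∀ A : Set (Below κ), #A < κ ↔ π ⁻¹' A ∈ K) ∧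
      (∃ e : PowerMod (bd hκ) ≃o PowerMod K,
        ∀ A : Set (Below κ), e (PowerMod.mk (bd hκ) A) = PowerMod.mk K (π ⁻¹' A)) ∧
      (∀ μ : Ordinal.{u}, μ ≤ κ.ord →
        ∃ e : ReducedPower (bd hκ) μ.ToType ≃ ReducedPower K μ.ToType,
          ∀ f : Below κ → μ.ToType,
            e (ReducedPower.mk (bd hκ) f) = ReducedPower.mk K (f ∘ π)) := by
  obtain ⟨e⟩ := hJcol
  obtain ⟨p₀, c₀, hbelow, hanti⟩ := exists_antichain hκ
  obtain ⟨π, hπ⟩ := exists_projection hκ hJ.complete e p₀ fun α β r h h' =>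
    hanti α β (Col.agree_of_le h h')
  obtain ⟨s, hs⟩ := exists_isTower hκ (mk_fun_le hκ hJ e) hdiamond p₀ c₀ hbelow
  have hmem : ∀ A, π ⁻¹' A ∈ towerIdeal hκ e hs ↔ A ∈ bd hκ := fun A =>
    preimage_mem_towerIdeal_iff hπ
  have hcard : ∀ A : Set (Below κ), #A < κ ↔ π ⁻¹' A ∈ towerIdeal hκ e hs := fun A =>
    (bddAbove_iff_mk_lt hκ).symm.trans (hmem A).symm
  refine ⟨towerIdeal hκ e hs, π, ?_, isCompleteIdeal_towerIdeal hJ.complete, le_towerIdeal,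
    hcard, exists_powerMod_orderIso hmem fun B => ?_,
    fun μ hμ => exists_reducedPower_equiv hmem
      (exists_comp_eq_mod_towerIdeal hJ.complete hπ ?_)⟩
  · refine Order.Ideal.isProper_of_notMem (p := univ) fun h => ?_
    rw [← preimage_univ (f := π), ← hcard, mk_univ, mk_ord_toType] at h
    exact lt_irrefl _ h
  · -- A set is treated as its characteristic function.
    obtain ⟨f, hf⟩ := exists_comp_eq_mod_towerIdeal (hs := hs) (hκ := hκ) hJ.complete hπ
      (M := ULift Prop) (by simpa using hκ.nat_lt 2 |>.le) fun x => ⟨x ∈ B⟩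
    refine ⟨{α | (f α).down}, mk_eq_mk.2 (mem_of_subset ?_ hf)⟩
    intro x hx heq
    have heq' : (f (π x)).down = (x ∈ B) := congrArg ULift.down heq
    rcases hx with ⟨h₁, h₂⟩ | ⟨h₁, h₂⟩
    · exact h₂ (heq'.mp h₁)
    · exact h₂ (heq'.mpr h₁)
  · rw [mk_toType]
    exact card_le_of_le_ord hμ
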